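/- Let $r\ge 1$ and let $k_1,\dots,k_r\ge 0$ be integers. For $s=(s_1,\dots,s_r)\in\mathbb C^r$ and $|z_1|,\dots,|z_r|<1$ put $$\mathrm{Li}^{\mathrm{sh}}_{s_1,\dots,s_r}(z_1,\dots,z_r)=\sum_{l_1,\dots,l_r\ge1}\frac{z_1^{l_1}\cdots z_r^{l_r}}{l_1^{s_1}(l_1+l_2)^{s_2}\cdots(l_1+\cdots+l_r)^{s_r}} .$$ (i) For the index $(-k_1,\dots,-k_r)$ this series converges absolutely on the open unit polydisc, and its sum continues analytically to $(\mathbb C\setminus[1,\infty))^r$; the continuation is denoted by the same symbol. (ii) If $\mathrm{Re}\,s_j>0$ for all $j$, then the integral in $$\eta(-k_1,\dots,-k_r;s_1,\dots,s_r)=\frac{1}{\prod_{j}\Gamma(s_j)}\int_{(0,\infty)^r}\prod_{j=1}^r t_j^{s_j-1}\,\frac{\mathrm{Li}^{\mathrm{sh}}_{-k_1,\dots,-k_r}\bigl(1-e^{t_1+\cdots+t_r},\dots,1-e^{t_{r-1}+t_r},1-e^{t_r}\bigr)}{\prod_{j=1}^r\bigl(1-e^{t_j+\cdots+t_r}\bigr)}\,dt_1\cdots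 dt_r$$ converges absolutely, and the function $\eta(-k_1,\dots,-k_r;\,\cdot\,)$ so defined continues analytically to an entire function on $\mathbb C^r$, denoted by the same symbol. (iii) For every $s\in\mathbb C^r$ the series $$F(x_1,\dots,x_r;s)=\sum_{l_1,\dots,l_r\ge1}\ \prod_{j=1}^r\frac{\bigl(1-e^{-(x_j+\cdots+x_r)}\bigr)^{l_j-1}}{(l_1+\cdots+l_j)^{s_j}}$$ $\Bigl(=\mathrm{Li}^{\mathrm{sh}}_{s_1,\dots,s_r}\bigl(1-e^{-(x_1+\cdots+x_r)},\dots,1-e^{-x_r}\bigr)\big/\prod_{j}\bigl(1-e^{-(x_j+\cdots+x_r)}\bigr)$ where the denominator is nonzero$\Bigr)$ converges absolutely whenever $|1-e^{-(x_j+\cdots+x_r)}|<1$ for all $j$. There are unique complex numbers $\mathbb B^{(s_1,\dots,s_r)}_{m_1,\dots,m_r}$, the multi-indexed poly-Bernoulli numbers, such that for all $x$ in a neighbourhood of $0$, with absolute convergence, $$F(x_1,\dots,x_r;s)=\sum_{m_1,\dots,m_r\ge0}\mathbb B^{(s_1,\dots,s_r)}_{m_1,\dots,m_r}\frac{x_1^{m_1}\cdots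 x_r^{m_r}}{m_1!\cdots m_r!}.$$ (iv) For all $(s_1,\dots,s_r)\in\mathbb C^r$, $$\eta(-k_1,\dots,-k_r;s_1,\dots,s_r)=\mathbb B^{(s_1,\dots,s_r)}_{k_1,\dots,k_r}.$$ -/

import Mathlib

open Set Filter Topology MeasureTheory

/-- `g` is analytic on `V` and agrees with `f` on `U`. -/
def IsAnalyticExtension {r : ℕ} (f : (Fin r → ℂ) → ℂ) (U V : Set (Fin r → ℂ))
    (g : (Fin r → ℂ) → ℂ) : Prop :=
  AnalyticOnNhd ℂ g V ∧ EqOn g f U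

/-- The analytic extension is unique on a connected domain `V` containing the nonempty open `U`. -/
theorem IsAnalyticExtension.eqOn {r : ℕ} {f g h : (Fin r → ℂ) → ℂ} {U V : Set (Fin r → ℂ)}
    (hg : IsAnalyticExtension f U V g) (hh : IsAnalyticExtension f U V h)
    (hU : IsOpen U) (hne : U.Nonempty) (hUV : U ⊆ V) (hV : IsPreconnected V) : EqOn g h V := by
  obtain ⟨z, hz⟩ := hne
  refine hg.1.eqOn_of_preconnected_of_eventuallyEq hh.1 hV (hUV hz) ?_
  filter_upwards [hU.mem_nhds hz] with w hw
  rw [hg.2 hw, hh.2 hw]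

open Classical in
/-- The analytic continuation of `f` from `U` to `V` (the function `f` itself if there is none). -/
noncomputable def analyticExtension {r : ℕ} (f : (Fin r → ℂ) → ℂ) (U V : Set (Fin r → ℂ)) :
    (Fin r → ℂ) → ℂ :=
  if h : ∃ g, IsAnalyticExtension f U V g then h.choose else f

/-- The tail sums `x_j + x_{j+1} + ⋯ + x_r`. -/
def tailSum {r : ℕ} {M : Type*} [AddCommMonoid M] (x : Fin r → M) (j : Fin r) : M :=
  ∑ ν ∈ Finset.Ici j, x ν

/-- `∏ j, (l_1 + ⋯ + l_j) ^ s_j`, where the positive integers `l_ν` are written as `l ν + 1`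
with `l ν : ℕ`. -/
noncomputable def headPow {r : ℕ} (s : Fin r → ℂ) (l : Fin r → ℕ) : ℂ :=
  ∏ j, ((∑ ν ∈ Finset.Iic j, (l ν + 1) : ℕ) : ℂ) ^ s j

/-- The general term of the multiple polylogarithm of shuffle type. -/
noncomputable def liShTerm {r : ℕ} (s z : Fin r → ℂ) (l : Fin r → ℕ) : ℂ :=
  (∏ j, z j ^ (l j + 1)) / headPow s l

/-- The series of the multiple polylogarithm of shuffle type,
`∑_{l_1, …, l_r ≥ 1} z_1^{l_1} ⋯ z_r^{l_r} / (l_1^{s_1} (l_1+l_2)^{s_2} ⋯ (l_1+⋯+l_r)^{s_r})`. -/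
noncomputable def liShSeries {r : ℕ} (s z : Fin r → ℂ) : ℂ :=
  ∑' l : Fin r → ℕ, liShTerm s z l

/-- The open unit polydisc, where the series converges for all complex `s`. -/
def polydisc (r : ℕ) : Set (Fin r → ℂ) := {z | ∀ j, ‖z j‖ < 1}

/-- The product of `r` copies of `ℂ ∖ [1, ∞)`. -/
def slitDomain (r : ℕ) : Set (Fin r → ℂ) := {z | ∀ j, ∀ a : ℝ, 1 ≤ a → z j ≠ (a : ℂ)}

/-- The multiple polylogarithm of shuffle type: the analytic continuation of the series from the
unit polydisc to `(ℂ ∖ [1, ∞))^r`. -/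
noncomputable def liSh {r : ℕ} (s : Fin r → ℂ) : (Fin r → ℂ) → ℂ :=
  analyticExtension (liShSeries s) (polydisc r) (slitDomain r)

/-- The index `(-k_1, …, -k_r)`. -/
def negIndex {r : ℕ} (k : Fin r → ℕ) : Fin r → ℂ := fun j => -(k j : ℂ)

/-- The integrand
`∏ t_j^{s_j-1} · Li(1 - e^{t_1+⋯+t_r}, …, 1 - e^{t_r}) / ∏ (1 - e^{t_j+⋯+t_r})`
of index `(-k_1, …, -k_r)`. -/
noncomputable def etaIntegrand {r : ℕ} (k : Fin r → ℕ) (s : Fin r → ℂ) (t : Fin r → ℝ) : ℂ :=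
  (∏ j, (t j : ℂ) ^ (s j - 1)) *
    (liSh (negIndex k) (fun j => 1 - Complex.exp (tailSum t j : ℝ)) /
      ∏ j, (1 - Complex.exp (tailSum t j : ℝ)))

/-- The positive orthant `(0, ∞)^r`. -/
def posOrthant (r : ℕ) : Set (Fin r → ℝ) := {t | ∀ j, 0 < t j}

/-- The domain `Re s_j > 0` for all `j`. -/
def rightHalf (r : ℕ) : Set (Fin r → ℂ) := {s | ∀ j, 0 < (s j).re}

/-- The integral that defines `η(-k_1, …, -k_r; s_1, …, s_r)` for `Re s_j > 0`. -/
noncomputable def etaIntegral {r : ℕ} (k : Fin r → ℕ) (s : Fin r → ℂ) : ℂ :=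
  (1 / ∏ j, Complex.Gamma (s j)) * ∫ t in posOrthant r, etaIntegrand k s t

/-- `η(-k_1, …, -k_r; s_1, …, s_r)`, as an entire function on `ℂ^r`: the analytic continuation
of the integral. -/
noncomputable def multiEta {r : ℕ} (k : Fin r → ℕ) : (Fin r → ℂ) → ℂ :=
  analyticExtension (etaIntegral k) (rightHalf r) univ

/-- The domain `|1 - e^{-(x_j+⋯+x_r)}| < 1` for all `j`. -/
def bernoulliDomain (r : ℕ) : Set (Fin r → ℂ) :=
  {x | (fun j => 1 - Complex.exp (-tailSum x j)) ∈ polydisc r}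

/-- The general term of the generating function: each `l_j ≥ 1` is written as `l j + 1`, so that
the exponent `l_j - 1` is `l j`. -/
noncomputable def bernoulliGenTerm {r : ℕ} (s x : Fin r → ℂ) (l : Fin r → ℕ) : ℂ :=
  (∏ j, (1 - Complex.exp (-tailSum x j)) ^ l j) / headPow s l

/-- The generating function
`∑_{l_1, …, l_r ≥ 1} ∏ (1 - e^{-(x_j+⋯+x_r)})^{l_j-1} / ∏ (l_1+⋯+l_j)^{s_j}`. -/
noncomputable def bernoulliGen {r : ℕ} (s x : Fin r → ℂ) : ℂ :=
  ∑' l : Fin r → ℕ, bernoulliGenTerm s x l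

/-- The generating function is the quotient
`Li(1 - e^{-(x_1+⋯+x_r)}, …, 1 - e^{-x_r}) / ∏ (1 - e^{-(x_j+⋯+x_r)})`
wherever the denominator does not vanish. -/
theorem bernoulliGen_eq_div {r : ℕ} (s x : Fin r → ℂ)
    (hx : ∏ j, (1 - Complex.exp (-tailSum x j)) ≠ 0) :
    bernoulliGen s x = liShSeries s (fun j => 1 - Complex.exp (-tailSum x j)) /
      ∏ j, (1 - Complex.exp (-tailSum x j)) := by
  unfold bernoulliGen liShSeries
  rw [← tsum_div_const]
  refine tsum_congr fun l => ?_
  simp only [bernoulliGenTerm, liShTerm, pow_succ, Finset.prod_mul_distrib]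
  field_simp

/-- The family `b` consists of the coefficients in the expansion
`f(x) = ∑ b_{m_1, …, m_r} x_1^{m_1} ⋯ x_r^{m_r} / (m_1! ⋯ m_r!)` near the origin. -/
def IsExpCoeff {r : ℕ} (f : (Fin r → ℂ) → ℂ) (b : (Fin r → ℕ) → ℂ) : Prop :=
  ∀ᶠ x in 𝓝 (0 : Fin r → ℂ),
    HasSum (fun m : Fin r → ℕ => b m * ∏ j, x j ^ m j / ((m j).factorial : ℂ)) (f x)

theorem expCoeff_eq_zero_one {c : ℕ → ℂ}
    (hc : ∀ᶠ z in 𝓝 (0 : ℂ), HasSum (fun n : ℕ => (z ^ n / (n.factorial : ℂ)) * c n) 0) (n : ℕ) :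
    c n = 0 := by
  have hps : HasFPowerSeriesAt (fun _ : ℂ => (0 : ℂ))
      (FormalMultilinearSeries.ofScalars ℂ (fun n : ℕ => c n / (n.factorial : ℂ))) 0 := by
    rw [hasFPowerSeriesAt_iff]
    filter_upwards [hc] with z hz
    have hf : (fun n => z ^ n • (FormalMultilinearSeries.ofScalars ℂ
        (fun n : ℕ => c n / (n.factorial : ℂ))).coeff n) =
        fun n : ℕ => (z ^ n / (n.factorial : ℂ)) * c n := by
      funext n
      rw [FormalMultilinearSeries.coeff_ofScalars, smul_eq_mul]
      ring
    rw [hf]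
    exact hz
  have h4 : c n / (n.factorial : ℂ) = 0 := by
    rw [← FormalMultilinearSeries.coeff_ofScalars (𝕜 := ℂ)
      (p := fun n : ℕ => c n / (n.factorial : ℂ)) (n := n), hps.eq_zero]
    rfl
  have h6 : (n.factorial : ℂ) ≠ 0 := by exact_mod_cast n.factorial_ne_zero
  simpa using (div_eq_iff h6).mp h4

theorem summable_expCoeff_fiber {β : Type*} {u : ℕ → ℂ} {g : ℕ → β → ℂ}
    (h : Summable (fun q : ℕ × β => u q.1 * g q.1 q.2)) (hu : ∀ n, u n ≠ 0) (n : ℕ) :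
    Summable (g n) :=
  (summable_mul_left_iff (hu n)).mp (h.prod_factor n)

theorem hasSum_expCoeff_fiber {β : Type*} {u : ℕ → ℂ} {g : ℕ → β → ℂ} {S : ℂ}
    (h : HasSum (fun q : ℕ × β => u q.1 * g q.1 q.2) S) (hg : ∀ n, Summable (g n)) :
    HasSum (fun n => u n * ∑' m, g n m) S :=
  h.prod_fiberwise (fun n => (hg n).hasSum.mul_left (u n))

theorem expCoeff_eq_zero {r : ℕ} {b : (Fin r → ℕ) → ℂ}
    (hb : IsExpCoeff (fun _ => 0) b) : b = 0 := by
  induction r with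
  | zero =>
    have h := hb.self_of_nhds
    funext m
    have h1 := h.unique (hasSum_unique _)
    simp only [Finset.univ_eq_empty, Finset.prod_empty, mul_one] at h1
    exact (congrArg b (Subsingleton.elim m _)).trans h1.symm
  | succ r ih =>
    have key : ∀ᶠ p in 𝓝 ((0 : ℂ), (0 : Fin r → ℂ)),
        HasSum (fun q : ℕ × (Fin r → ℕ) => (p.1 ^ q.1 / (q.1.factorial : ℂ)) *
          (b (Fin.cons q.1 q.2) * ∏ j, p.2 j ^ q.2 j / ((q.2 j).factorial : ℂ))) 0 := by
      have hc : Continuous (fun p : ℂ × (Fin r → ℂ) => (Fin.cons p.1 p.2 : Fin (r + 1) → ℂ)) := by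
        fun_prop
      have h0 : Tendsto (fun p : ℂ × (Fin r → ℂ) => (Fin.cons p.1 p.2 : Fin (r + 1) → ℂ))
          (𝓝 (0, 0)) (𝓝 0) := by
        have := hc.tendsto (0, 0)
        convert this using 2
        funext j
        refine Fin.cases ?_ (fun _ => ?_) j <;> simp
      filter_upwards [h0.eventually hb] with p hp
      have h2 := (Fin.consEquiv (fun _ : Fin (r + 1) => ℕ)).hasSum_iff.mpr hp
      convert h2 using 2 with q
      have hq : (Fin.consEquiv (fun _ : Fin (r + 1) => ℕ)) q = Fin.cons q.1 q.2 := rfl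
      simp only [Function.comp, hq, Fin.prod_univ_succ, Fin.cons_zero, Fin.cons_succ]
      ring
    rw [nhds_prod_eq] at key
    obtain ⟨pa, ha, pb, hpb, hab⟩ := eventually_prod_iff.mp key
    obtain ⟨a, haa, ha0⟩ := ((ha.filter_mono nhdsWithin_le_nhds).and
      (eventually_mem_nhdsWithin (a := (0 : ℂ)) (s := {0}ᶜ))).exists
    have hfac : ∀ n : ℕ, a ^ n / (n.factorial : ℂ) ≠ 0 := fun n =>
      div_ne_zero (pow_ne_zero _ ha0) (by exact_mod_cast n.factorial_ne_zero)
    obtain ⟨c, hcb⟩ : ∃ c : ℕ → (Fin r → ℕ) → ℂ, ∀ n m, b (Fin.cons n m) = c n m :=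
      ⟨fun n m => b (Fin.cons n m), fun _ _ => rfl⟩
    have hab' : ∀ {z : ℂ}, pa z → ∀ {y : Fin r → ℂ}, pb y →
        HasSum (fun q : ℕ × (Fin r → ℕ) => (z ^ q.1 / (q.1.factorial : ℂ)) *
          (c q.1 q.2 * ∏ j, y j ^ q.2 j / ((q.2 j).factorial : ℂ))) 0 := by
      intro z hz y hy
      simpa only [hcb] using hab hz hy
    have hz : ∀ n : ℕ, (fun m => b (Fin.cons n m)) = 0 := by
      intro n
      simp only [hcb]
      refine ih ?_
      filter_upwards [hpb] with y hy
      have hs : ∀ n : ℕ, Summable (fun m : Fin r → ℕ =>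
          c n m * ∏ j, y j ^ m j / ((m j).factorial : ℂ)) :=
        summable_expCoeff_fiber (u := fun n => a ^ n / (n.factorial : ℂ))
          (g := fun n m => c n m * ∏ j, y j ^ m j / ((m j).factorial : ℂ))
          (hab' haa hy).summable hfac
      have h5 := expCoeff_eq_zero_one (c := fun n => ∑' m : Fin r → ℕ,
          c n m * ∏ j, y j ^ m j / ((m j).factorial : ℂ)) (by
        filter_upwards [ha] with z hz
        exact hasSum_expCoeff_fiber (u := fun n => z ^ n / (n.factorial : ℂ))
          (g := fun n m => c n m * ∏ j, y j ^ m j / ((m j).factorial : ℂ)) (hab' hz hy) hs) n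
      rw [← h5]
      exact (hs n).hasSum
    funext m
    rw [← Fin.cons_self_tail m]
    exact congrFun (hz (m 0)) (Fin.tail m)

/-- The coefficients of such an expansion are unique. -/
theorem IsExpCoeff.unique {r : ℕ} {f : (Fin r → ℂ) → ℂ} {b c : (Fin r → ℕ) → ℂ}
    (hb : IsExpCoeff f b) (hc : IsExpCoeff f c) : b = c := by
  refine sub_eq_zero.mp (expCoeff_eq_zero (b := b - c) ?_)
  filter_upwards [hb, hc] with x h1 h2
  simpa [sub_mul] using h1.sub h2

open Classical in
/-- The multi-indexed poly-Bernoulli number with lower index `m` and upper index `s`: the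
coefficient of `x_1^{m_1} ⋯ x_r^{m_r} / (m_1! ⋯ m_r!)` in the expansion of the generating
function (`0` if there were no expansion). -/
noncomputable def multiPolyBernoulli {r : ℕ} (s : Fin r → ℂ) (m : Fin r → ℕ) : ℂ :=
  if h : ∃ b, IsExpCoeff (bernoulliGen s) b then h.choose m else 0

/-! Both sides equal one finite sum. Put `w_j = 1 - exp (-(x_j + ⋯ + x_r))`, and let `c(m, l)` be
the coefficient of `∏ x_j^{m_j} / m_j!` in `∏ w_j^{l_j}` (`expCoeffProd`). As `w_j` vanishes at the
origin, `c(m, l) = 0` once `∑ l_j > ∑ m_j`. Let `N_j(l) = ∑_{ν ≤ j} (l_ν + 1)`. The generating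
function has coefficients `∏ N_j(l)^{-s_j}` in powers of `w`, so the Bernoulli number at `k` is `∑_l
c(k, l) ∏ N_j(l)^{-s_j}`.

The same `c(k, l)` govern the polylogarithm. Exchanging head sums for tail sums gives `exp (∑ N_j(n)
x_j) = ∏ (1 - w_j)^{-(n_j+1)}`. Expanding in `w` and comparing coefficients at `k` yields `∏
N_j(n)^{k_j} = ∑_l c(k, l) ∏ binom(n_j + l_j, l_j)` (`prod_headSum_pow_eq`). Summation against `∏
z_j^{n_j+1}` gives the rational function `∑_l c(k, l) ∏ z_j / (1 - z_j)^{l_j+1}`. At `z_j = 1 - exp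
(t_j + ⋯ + t_r)`, after division by `∏ z_j`, each product becomes `exp (-∑ N_j(l) t_j)`, and Gamma
integrals return `∏ N_j(l)^{-s_j}`. This finite sum is entire in `s`, so the identity theorem
extends the equality to all `s`. -/

/-! ### Absolutely convergent series and evaluation of formal power series -/

/-- A product of absolutely convergent series, indexed by tuples. -/
theorem hasSum_fin_prod {𝕜 : Type*} [NormedField 𝕜] [CompleteSpace 𝕜] {r : ℕ}
    {f : Fin r → ℕ → 𝕜} {S : Fin r → 𝕜}
    (hf : ∀ j, Summable fun n => ‖f j n‖) (hS : ∀ j, HasSum (f j) (S j)) :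
    (Summable fun l : Fin r → ℕ => ‖∏ j, f j (l j)‖) ∧
      HasSum (fun l : Fin r → ℕ => ∏ j, f j (l j)) (∏ j, S j) := by
  induction r with
  | zero => exact ⟨(hasSum_unique _).summable, by simp⟩
  | succ r ih =>
    obtain ⟨h1, h2⟩ := ih (fun j => hf j.succ) (fun j => hS j.succ)
    have e : ∀ q : ℕ × (Fin r → ℕ), ∏ j, f j (Fin.consEquiv (fun _ : Fin (r + 1) => ℕ) q j) =
        f 0 q.1 * ∏ j, f j.succ (q.2 j) := fun q => by
      simp [Fin.consEquiv, Fin.prod_univ_succ]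
    constructor
    · rw [← (Fin.consEquiv (fun _ : Fin (r + 1) => ℕ)).summable_iff]
      refine ((hf 0).mul_norm h1).congr fun q => ?_
      rw [Function.comp_apply, e]
    · rw [← (Fin.consEquiv (fun _ : Fin (r + 1) => ℕ)).hasSum_iff, Fin.prod_univ_succ]
      have hs : Summable fun q : ℕ × (Fin r → ℕ) => f 0 q.1 * ∏ j, f j.succ (q.2 j) :=
        ((hf 0).mul_norm h1).of_norm
      have h := HasSum.mul (hS 0) h2 hs
      simp only [← e] at h
      exact h

theorem hasSum_fin_prod_exp {𝕜 : Type*} [RCLike 𝕜] {r : ℕ} (y : Fin r → 𝕜) :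
    HasSum (fun m : Fin r → ℕ => ∏ j, y j ^ m j / ((m j).factorial : 𝕜))
      (NormedSpace.exp (∑ j, y j)) := by
  rw [NormedSpace.exp_sum]
  exact (hasSum_fin_prod (f := fun j n => y j ^ n / (n.factorial : 𝕜))
    (fun j => NormedSpace.norm_expSeries_div_summable (y j))
    (fun j => NormedSpace.expSeries_div_hasSum_exp (y j))).2

/-- The bound on the sum of norms is carried along because substituting one power series into
another requires uniform control of all powers. -/
theorem hasSum_cauchyProduct {A : Type*} [AddCommMonoid A] [Finset.HasAntidiagonal A]
    {f g : A → ℂ} {v w : ℂ} (hf : HasSum f v) (hg : HasSum g w)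
    (hf' : Summable fun a => ‖f a‖) (hg' : Summable fun a => ‖g a‖) :
    HasSum (fun a => ∑ kl ∈ Finset.HasAntidiagonal.antidiagonal a, f kl.1 * g kl.2) (v * w) ∧
      (Summable fun a => ‖∑ kl ∈ Finset.HasAntidiagonal.antidiagonal a, f kl.1 * g kl.2‖) ∧
      ∑' a, ‖∑ kl ∈ Finset.HasAntidiagonal.antidiagonal a, f kl.1 * g kl.2‖ ≤
        (∑' a, ‖f a‖) * ∑' a, ‖g a‖ := by
  have hs := summable_mul_of_summable_norm hf' hg'
  have hn := hf'.mul_of_nonneg hg' (fun _ => norm_nonneg _) fun _ => norm_nonneg _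
  have hn' := summable_sum_mul_antidiagonal_of_summable_mul (f := fun a => ‖f a‖)
    (g := fun a => ‖g a‖) hn
  have hle : ∀ a, ‖∑ kl ∈ Finset.HasAntidiagonal.antidiagonal a, f kl.1 * g kl.2‖ ≤
      ∑ kl ∈ Finset.HasAntidiagonal.antidiagonal a, ‖f kl.1‖ * ‖g kl.2‖ := fun a =>
    (norm_sum_le _ _).trans_eq (Finset.sum_congr rfl fun kl _ => norm_mul _ _)
  have hsum := hn'.of_nonneg_of_le (fun _ => norm_nonneg _) hle
  refine ⟨?_, hsum, ?_⟩
  · rw [← hf.tsum_eq, ← hg.tsum_eq,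
      hf.summable.tsum_mul_tsum_eq_tsum_sum_antidiagonal hg.summable hs]
    exact (summable_sum_mul_antidiagonal_of_summable_mul (f := f) (g := g) hs).hasSum
  · rw [Summable.tsum_mul_tsum_eq_tsum_sum_antidiagonal (f := fun a => ‖f a‖)
      (g := fun a => ‖g a‖) hf' hg' hn]
    exact hsum.tsum_le_tsum hle hn'

/-- The power series `p` converges absolutely at `x` to `v`, and `M` bounds the sum of the norms
of its terms. -/
def HasEvalBound {r : ℕ} (x : Fin r → ℂ) (p : MvPowerSeries (Fin r) ℂ) (v : ℂ) (M : ℝ) : Prop :=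
  HasSum (fun d => p.coeff d * ∏ j, x j ^ d j) v ∧
    (Summable fun d => ‖p.coeff d * ∏ j, x j ^ d j‖) ∧ ∑' d, ‖p.coeff d * ∏ j, x j ^ d j‖ ≤ M

namespace HasEvalBound

variable {r : ℕ} {x : Fin r → ℂ} {p q : MvPowerSeries (Fin r) ℂ} {v w : ℂ} {M N : ℝ}

theorem nonneg (h : HasEvalBound x p v M) : 0 ≤ M :=
  (tsum_nonneg fun _ => norm_nonneg _).trans h.2.2

theorem one : HasEvalBound x 1 1 1 := by
  have h : ∀ d : Fin r →₀ ℕ, (1 : MvPowerSeries (Fin r) ℂ).coeff d * ∏ j, x j ^ d j =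
      if d = 0 then 1 else 0 := by
    intro d
    rw [MvPowerSeries.coeff_one]
    split_ifs with hd
    · simp [hd]
    · simp
  have h' : ∀ d : Fin r →₀ ℕ, ‖if d = 0 then (1 : ℂ) else 0‖ = if d = 0 then 1 else 0 := by
    intro d
    split_ifs <;> simp
  simp only [HasEvalBound, h, h']
  have := hasSum_ite_eq (0 : Fin r →₀ ℕ) (1 : ℝ)
  exact ⟨hasSum_ite_eq _ _, this.summable, this.tsum_eq.le⟩

theorem mul (hp : HasEvalBound x p v M) (hq : HasEvalBound x q w N) :
    HasEvalBound x (p * q) (v * w) (M * N) := by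
  classical
  have e : ∀ d, (p * q).coeff d * ∏ j, x j ^ d j = ∑ kl ∈ Finset.HasAntidiagonal.antidiagonal d,
      (p.coeff kl.1 * ∏ j, x j ^ kl.1 j) * (q.coeff kl.2 * ∏ j, x j ^ kl.2 j) := by
    intro d
    rw [MvPowerSeries.coeff_mul, Finset.sum_mul]
    refine Finset.sum_congr rfl fun kl hkl => ?_
    rw [← Finset.HasAntidiagonal.mem_antidiagonal.mp hkl]
    simp only [Finsupp.add_apply, pow_add, Finset.prod_mul_distrib]
    ring
  obtain ⟨h1, h2, h3⟩ := hasSum_cauchyProduct hp.1 hq.1 hp.2.1 hq.2.1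
  simp only [HasEvalBound, e]
  exact ⟨h1, h2, h3.trans (mul_le_mul hp.2.2 hq.2.2 (tsum_nonneg fun _ => norm_nonneg _) hp.nonneg)⟩

theorem pow (hp : HasEvalBound x p v M) (n : ℕ) : HasEvalBound x (p ^ n) (v ^ n) (M ^ n) := by
  induction n with
  | zero => simpa using one
  | succ n ih => simpa only [pow_succ] using ih.mul hp

theorem prod {ι : Type*} (s : Finset ι) {p : ι → MvPowerSeries (Fin r) ℂ} {v : ι → ℂ} {M : ι → ℝ}
    (h : ∀ i, HasEvalBound x (p i) (v i) (M i)) :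
    HasEvalBound x (∏ i ∈ s, p i) (∏ i ∈ s, v i) (∏ i ∈ s, M i) := by
  classical
  induction s using Finset.induction_on with
  | empty => simpa using one
  | insert i s hi ih => simpa only [Finset.prod_insert hi] using (h i).mul ih

end HasEvalBound

/-! ### Expansion in powers of `1 - exp (-(x_j + ⋯ + x_r))` -/

/-- The Taylor series of `1 - exp (-(x_j + ⋯ + x_r))` at the origin. -/
noncomputable def oneSubExpSeries {r : ℕ} (j : Fin r) : MvPowerSeries (Fin r) ℂ :=
  1 - (show MvPowerSeries (Fin r) ℂ from
    fun d => ∏ ν, (if j ≤ ν then -1 else 0) ^ d ν / ((d ν).factorial : ℂ))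

theorem coeff_oneSubExpSeries {r : ℕ} (j : Fin r) (d : Fin r →₀ ℕ) :
    (oneSubExpSeries j).coeff d = (if d = 0 then 1 else 0) -
      ∏ ν, (if j ≤ ν then -1 else 0) ^ d ν / ((d ν).factorial : ℂ) := by
  classical
  rw [oneSubExpSeries, map_sub, MvPowerSeries.coeff_one]
  rfl

theorem constantCoeff_oneSubExpSeries {r : ℕ} (j : Fin r) :
    (oneSubExpSeries j).constantCoeff = 0 := by
  rw [← MvPowerSeries.coeff_zero_eq_constantCoeff_apply, coeff_oneSubExpSeries]
  simp

theorem tailSum_eq_sum_ite {r : ℕ} {R : Type*} [CommSemiring R] (x : Fin r → R) (j : Fin r) :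
    tailSum x j = ∑ ν, (if j ≤ ν then 1 else 0) * x ν := by
  simp [tailSum, ← Finset.sum_filter, Finset.filter_le_eq_Ici]

/-- The constant terms cancel, and the other terms have the same norms as those of the exponential
series at the `‖x ν‖`. The resulting bound tends to `0` with `x`, so it falls below any prescribed
radius. -/
theorem hasEvalBound_oneSubExpSeries {r : ℕ} (x : Fin r → ℂ) (j : Fin r) :
    HasEvalBound x (oneSubExpSeries j) (1 - Complex.exp (-tailSum x j))
      (Real.exp (∑ ν, ‖x ν‖) - 1) := by
  have hC := (Finsupp.equivFunOnFinite (α := Fin r) (M := ℕ)).hasSum_iff.mpr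
    (hasSum_fin_prod_exp (𝕜 := ℂ) fun ν => (if j ≤ ν then -1 else 0) * x ν)
  have hR := (Finsupp.equivFunOnFinite (α := Fin r) (M := ℕ)).hasSum_iff.mpr
    (hasSum_fin_prod_exp (𝕜 := ℝ) fun ν => (if j ≤ ν then 1 else 0) * ‖x ν‖)
  rw [← Complex.exp_eq_exp_ℂ] at hC
  rw [← Real.exp_eq_exp_ℝ] at hR
  have e : ∀ d : Fin r →₀ ℕ, (oneSubExpSeries j).coeff d * ∏ ν, x ν ^ d ν =
      (if d = 0 then 1 else 0) -
        ∏ ν, ((if j ≤ ν then -1 else 0) * x ν) ^ d ν / ((d ν).factorial : ℂ) := by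
    intro d
    have h0 : (if d = 0 then (1 : ℂ) else 0) * ∏ ν, x ν ^ d ν = if d = 0 then 1 else 0 := by
      split_ifs with hd <;> simp [hd]
    rw [coeff_oneSubExpSeries, sub_mul, h0, ← Finset.prod_mul_distrib]
    congr 1
    refine Finset.prod_congr rfl fun ν _ => ?_
    rw [mul_pow]
    ring
  have e' : ∀ d : Fin r →₀ ℕ, ‖(oneSubExpSeries j).coeff d * ∏ ν, x ν ^ d ν‖ =
      (∏ ν, ((if j ≤ ν then 1 else 0) * ‖x ν‖) ^ d ν / ((d ν).factorial : ℝ)) -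
        if d = 0 then 1 else 0 := by
    intro d
    rw [e]
    split_ifs with hd
    · simp [hd]
    · rw [zero_sub, norm_neg, sub_zero, norm_prod]
      refine Finset.prod_congr rfl fun ν _ => ?_
      rw [norm_div, norm_pow, norm_mul, Complex.norm_natCast]
      split_ifs <;> simp
  have hR' := hR.sub (hasSum_ite_eq (0 : Fin r →₀ ℕ) (1 : ℝ))
  have hC' := (hasSum_ite_eq (0 : Fin r →₀ ℕ) (1 : ℂ)).sub hC
  simp only [HasEvalBound, e']
  simp only [e]
  refine ⟨?_, hR'.summable, hR'.tsum_eq.le.trans ?_⟩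
  · have ht : -tailSum x j = ∑ ν, (if j ≤ ν then -1 else 0) * x ν := by
      rw [tailSum_eq_sum_ite, ← Finset.sum_neg_distrib]
      refine Finset.sum_congr rfl fun ν _ => ?_
      split_ifs <;> simp
    rw [ht]
    exact hC'
  · gcongr with ν
    split_ifs <;> simp

/-- The coefficient of `x_1^{m_1} ⋯ x_r^{m_r} / (m_1! ⋯ m_r!)` in
`∏ j, (1 - exp (-(x_j + ⋯ + x_r))) ^ l_j`. -/
noncomputable def expCoeffProd {r : ℕ} (m l : Fin r → ℕ) : ℂ :=
  (∏ j, ((m j).factorial : ℂ)) *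
    (∏ j, oneSubExpSeries j ^ l j).coeff (Finsupp.equivFunOnFinite.symm m)

/-- Each factor has no constant term, so the product has order at least `∑ l_j`. -/
theorem expCoeffProd_eq_zero {r : ℕ} {m l : Fin r → ℕ} (h : ∑ j, m j < ∑ j, l j) :
    expCoeffProd m l = 0 := by
  rw [expCoeffProd, MvPowerSeries.coeff_of_lt_order, mul_zero]
  refine lt_of_lt_of_le ?_ (MvPowerSeries.le_order_prod _ _)
  have h1 : ((∑ j, l j : ℕ) : ℕ∞) ≤ ∑ j, (oneSubExpSeries j ^ l j).order := by
    push_cast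
    exact Finset.sum_le_sum fun j _ => MvPowerSeries.le_order_pow_of_constantCoeff_eq_zero _
      (constantCoeff_oneSubExpSeries j)
  refine lt_of_lt_of_le ?_ h1
  rw [Finsupp.degree_eq_sum]
  exact_mod_cast h

/-- A finite set of indices outside of which `expCoeffProd m` vanishes. -/
def expCoeffBox {r : ℕ} (m : Fin r → ℕ) : Finset (Fin r → ℕ) :=
  Fintype.piFinset fun _ => Finset.range (∑ j, m j + 1)

theorem expCoeffProd_eq_zero_of_notMem {r : ℕ} {m l : Fin r → ℕ} (h : l ∉ expCoeffBox m) :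
    expCoeffProd m l = 0 := by
  simp only [expCoeffBox, Fintype.mem_piFinset, Finset.mem_range, not_forall, not_lt] at h
  obtain ⟨j, hj⟩ := h
  exact expCoeffProd_eq_zero
    ((Nat.lt_of_succ_le hj).trans_le (Finset.single_le_sum (fun _ _ => Nat.zero_le _) (by simp)))

/-- A power series in the functions `1 - exp (-(x_j + ⋯ + x_r))` expands in powers of `x`. -/
theorem isExpCoeff_tsum_oneSubExp {r : ℕ} {a : (Fin r → ℕ) → ℂ} {ρ : ℝ} (hρ : 0 < ρ)
    (ha : Summable fun l => ‖a l‖ * ∏ j, ρ ^ l j) :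
    IsExpCoeff (fun x => ∑' l, a l * ∏ j, (1 - Complex.exp (-tailSum x j)) ^ l j)
      (fun m => ∑ l ∈ expCoeffBox m, a l * expCoeffProd m l) := by
  have hx : ∀ᶠ x : Fin r → ℂ in 𝓝 0, Real.exp (∑ ν, ‖x ν‖) - 1 < ρ := by
    have hc : Continuous fun x : Fin r → ℂ => Real.exp (∑ ν, ‖x ν‖) - 1 := by fun_prop
    exact (hc.tendsto 0).eventually_lt_const (by simpa using hρ)
  filter_upwards [hx] with x hx
  have hW : ∀ j : Fin r, HasEvalBound x (oneSubExpSeries j) (1 - Complex.exp (-tailSum x j)) ρ :=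
    fun j =>
      have h := hasEvalBound_oneSubExpSeries x j
      ⟨h.1, h.2.1, h.2.2.trans hx.le⟩
  have hP := fun l : Fin r → ℕ => HasEvalBound.prod Finset.univ fun j => (hW j).pow (l j)
  -- The double series over exponents `l` of the outer series and monomials `d` in `x`. It is summed
  -- in both orders.
  set F : (Fin r → ℕ) × (Fin r →₀ ℕ) → ℂ := fun q =>
    a q.1 * ((∏ j, oneSubExpSeries j ^ q.1 j).coeff q.2 * ∏ j, x j ^ q.2 j) with hF
  -- For fixed `l` the norms sum to at most `‖a l‖ ∏ ρ ^ l j`, which is summable by `ha`.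
  have hFs : Summable F := by
    refine Summable.of_norm ((summable_prod_of_nonneg fun _ => norm_nonneg _).mpr ⟨fun l => ?_, ?_⟩)
    · simp only [hF, norm_mul (a l)]
      exact (hP l).2.1.mul_left _
    · refine ha.of_nonneg_of_le (fun _ => tsum_nonneg fun _ => norm_nonneg _) fun l => ?_
      simp only [hF, norm_mul (a l)]
      rw [tsum_mul_left]
      exact mul_le_mul_of_nonneg_left (hP l).2.2 (norm_nonneg _)
  have h1 := hFs.hasSum.prod_fiberwise fun l => (hP l).1.mul_left (a l)
  have h2 : HasSum (F ∘ Prod.swap) (∑' q, F q) :=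
    (Equiv.prodComm (Fin r →₀ ℕ) (Fin r → ℕ)).hasSum_iff.mpr hFs.hasSum
  have h3 := h2.prod_fiberwise (g := fun d : Fin r →₀ ℕ => (∑ l ∈ expCoeffBox d, a l * expCoeffProd d l) *
      ∏ j, x j ^ d j / ((d j).factorial : ℂ)) fun d => by
    have e : ∀ l : Fin r → ℕ, (F ∘ Prod.swap) (d, l) =
        a l * expCoeffProd d l * ∏ j, x j ^ d j / ((d j).factorial : ℂ) := by
      intro l
      have hne : ∏ j, ((d j).factorial : ℂ) ≠ 0 :=
        Finset.prod_ne_zero_iff.mpr fun j _ => by exact_mod_cast (d j).factorial_ne_zero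
      have hd : Finsupp.equivFunOnFinite.symm (d : Fin r → ℕ) = d :=
        Finsupp.equivFunOnFinite.symm_apply_apply d
      simp only [hF, Function.comp_apply, Prod.swap, expCoeffProd, Finset.prod_div_distrib, hd]
      field_simp
    rw [Finset.sum_mul]
    simp only [e]
    -- For a fixed monomial only the `l` in the box contribute, so the inner sum is finite.
    refine hasSum_sum_of_ne_finset_zero fun l hl => ?_
    rw [expCoeffProd_eq_zero_of_notMem hl, mul_zero, zero_mul]
  rw [h1.tsum_eq]
  exact (Finsupp.equivFunOnFinite (α := Fin r) (M := ℕ)).hasSum_iff.mp h3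

/-! ### Head sums and convergence of the generating series -/

/-- The head sums `l_1 + ⋯ + l_j`, where each `l_ν` is written as `l ν + 1`. -/
def headSum {r : ℕ} (l : Fin r → ℕ) (j : Fin r) : ℕ := ∑ ν ∈ Finset.Iic j, (l ν + 1)

theorem headPow_eq {r : ℕ} (s : Fin r → ℂ) (l : Fin r → ℕ) :
    headPow s l = ∏ j, (headSum l j : ℂ) ^ s j := rfl

theorem headSum_pos {r : ℕ} (l : Fin r → ℕ) (j : Fin r) : 0 < headSum l j :=
  Finset.sum_pos (fun _ _ => Nat.succ_pos _) ⟨j, by simp⟩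

theorem headSum_le_prod {r : ℕ} (l : Fin r → ℕ) (j : Fin r) : headSum l j ≤ ∏ ν, (l ν + 2) := by
  have h : ∀ S : Finset (Fin r), ∑ ν ∈ S, (l ν + 1) ≤ ∏ ν ∈ S, (l ν + 2) := by
    intro S
    induction S using Finset.induction_on with
    | empty => simp
    | insert i S hi ih =>
      rw [Finset.sum_insert hi, Finset.prod_insert hi]
      have : 1 ≤ ∏ ν ∈ S, (l ν + 2) := Finset.prod_pos fun _ _ => Nat.succ_pos _
      nlinarith
  exact (h _).trans (Finset.prod_le_prod_of_subset_of_one_le' (Finset.subset_univ _)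
    fun i _ _ => by omega)

/-- Both sides sum `(l_ν + 1) x_j` over `ν ≤ j`. This duality links the denominators, built on head
sums, with the arguments, built on tail sums. -/
theorem sum_mul_headSum {r : ℕ} {R : Type*} [CommSemiring R] (x : Fin r → R) (l : Fin r → ℕ) :
    ∑ j, (headSum l j : R) * x j = ∑ j, ((l j + 1 : ℕ) : R) * tailSum x j := by
  simp only [headSum, tailSum, Nat.cast_sum, Finset.sum_mul, Finset.mul_sum]
  exact Finset.sum_comm' (by simp)

theorem headPow_negIndex {r : ℕ} (k l : Fin r → ℕ) :
    headPow (negIndex k) l = (∏ j, (headSum l j : ℂ) ^ k j)⁻¹ := by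
  simp only [headPow_eq, negIndex, Complex.cpow_neg, Complex.cpow_natCast, Finset.prod_inv_distrib]

/-- Polynomial growth in product form: a product over the indices can be compared with a product of
one-variable series. -/
theorem norm_headPow_inv_le {r : ℕ} (s : Fin r → ℂ) :
    ∃ K : ℕ, ∀ l : Fin r → ℕ, ‖(headPow s l)⁻¹‖ ≤ ∏ ν, ((l ν : ℝ) + 2) ^ K := by
  refine ⟨∑ j, ⌈‖s j‖⌉₊, fun l => ?_⟩
  rw [headPow_eq, norm_inv, norm_prod, ← Finset.prod_inv_distrib, Finset.prod_pow,
    ← Finset.prod_pow_eq_pow_sum]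
  refine Finset.prod_le_prod (fun _ _ => by positivity) fun j _ => ?_
  have h1 : (1 : ℝ) ≤ headSum l j := by exact_mod_cast headSum_pos l j
  have h2 : (headSum l j : ℝ) ≤ ∏ ν, ((l ν : ℝ) + 2) := by exact_mod_cast headSum_le_prod l j
  rw [Complex.norm_natCast_cpow_of_pos (headSum_pos l j), ← Real.rpow_neg (by positivity)]
  calc (headSum l j : ℝ) ^ (-(s j).re) ≤ (headSum l j : ℝ) ^ ((⌈‖s j‖⌉₊ : ℕ) : ℝ) :=
        Real.rpow_le_rpow_of_exponent_le h1
          ((neg_le_abs _).trans ((Complex.abs_re_le_norm _).trans (Nat.le_ceil _)))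
    _ = (headSum l j : ℝ) ^ ⌈‖s j‖⌉₊ := Real.rpow_natCast _ _
    _ ≤ _ := by gcongr

theorem summable_add_two_pow_mul_geometric (K : ℕ) {t : ℝ} (h0 : 0 ≤ t) (h1 : t < 1) :
    Summable fun n : ℕ => ((n : ℝ) + 2) ^ K * t ^ n := by
  -- The general case shifts `∑ n ^ K * t ^ n` by two and divides by `t ^ 2`, which excludes `t =
  -- 0`.
  rcases h0.eq_or_lt with rfl | h0
  · exact summable_of_ne_finset_zero (s := {0}) fun n hn => by
      rw [zero_pow (by simpa using hn), mul_zero]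
  · have h := (summable_nat_add_iff 2).mpr (summable_pow_mul_geometric_of_norm_lt_one K
      (r := t) (by rwa [Real.norm_of_nonneg h0.le]))
    refine (h.mul_right (t ^ 2)⁻¹).congr fun n => ?_
    push_cast
    field_simp
    ring

theorem summable_norm_prod_pow_div_headPow {r : ℕ} (s : Fin r → ℂ) {z : Fin r → ℂ}
    (hz : z ∈ polydisc r) :
    Summable fun l : Fin r → ℕ => ‖(∏ j, z j ^ l j) / headPow s l‖ := by
  obtain ⟨K, hK⟩ := norm_headPow_inv_le s
  have h := fun j => summable_add_two_pow_mul_geometric K (norm_nonneg (z j)) (hz j)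
  refine (hasSum_fin_prod (f := fun j n => ((n : ℝ) + 2) ^ K * ‖z j‖ ^ n) (fun j => (h j).norm)
    fun j => (h j).hasSum).2.summable.of_nonneg_of_le (fun _ => norm_nonneg _) fun l => ?_
  rw [div_eq_mul_inv, norm_mul, mul_comm, Finset.prod_mul_distrib]
  simp only [norm_prod, norm_pow]
  exact mul_le_mul_of_nonneg_right (hK l) (by positivity)

theorem summable_bernoulliGenTerm {r : ℕ} (s : Fin r → ℂ) {x : Fin r → ℂ}
    (hx : x ∈ bernoulliDomain r) : Summable (bernoulliGenTerm s x) :=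
  (summable_norm_prod_pow_div_headPow s hx).of_norm

theorem isExpCoeff_bernoulliGen {r : ℕ} (s : Fin r → ℂ) :
    IsExpCoeff (bernoulliGen s)
      (fun m => ∑ l ∈ expCoeffBox m, (headPow s l)⁻¹ * expCoeffProd m l) := by
  have h := isExpCoeff_tsum_oneSubExp (a := fun l : Fin r → ℕ => (headPow s l)⁻¹)
    -- Any radius in `(0, 1)` would do: the series converges at the point with all coordinates `ρ`.
    (ρ := 1 / 2) (by norm_num) <| by
      refine (summable_norm_prod_pow_div_headPow s (z := fun _ => 1 / 2) ?_).congr fun l => ?_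
      · intro j
        norm_num
      · rw [div_eq_mul_inv, norm_mul, mul_comm]
        simp [norm_prod]
  filter_upwards [h] with x hx
  convert hx using 1
  refine tsum_congr fun l => ?_
  rw [bernoulliGenTerm, div_eq_mul_inv, mul_comm]

/-! ### Poly-Bernoulli numbers as finite sums -/

theorem multiPolyBernoulli_spec {r : ℕ} (s : Fin r → ℂ) :
    IsExpCoeff (bernoulliGen s) (multiPolyBernoulli s) := by
  have h : ∃ b, IsExpCoeff (bernoulliGen s) b := ⟨_, isExpCoeff_bernoulliGen s⟩
  have e : multiPolyBernoulli s = h.choose := by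
    funext m
    rw [multiPolyBernoulli, dif_pos h]
  rw [e]
  exact h.choose_spec

theorem multiPolyBernoulli_eq_sum {r : ℕ} (s : Fin r → ℂ) (m : Fin r → ℕ) :
    multiPolyBernoulli s m = ∑ l ∈ expCoeffBox m, (headPow s l)⁻¹ * expCoeffProd m l :=
  congrFun ((multiPolyBernoulli_spec s).unique (isExpCoeff_bernoulliGen s)) m

theorem eventually_mem_bernoulliDomain (r : ℕ) : ∀ᶠ x in 𝓝 (0 : Fin r → ℂ),
    x ∈ bernoulliDomain r := by
  refine eventually_all.mpr fun j => ?_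
  have hc : Continuous fun x : Fin r → ℂ => ‖1 - Complex.exp (-tailSum x j)‖ := by
    unfold tailSum
    fun_prop
  exact (hc.tendsto 0).eventually_lt_const (by simp [tailSum])

/-! ### Monomials in the head sums -/

theorem isExpCoeff_exp_sum_mul {r : ℕ} (y : Fin r → ℂ) :
    IsExpCoeff (fun x => Complex.exp (∑ j, y j * x j)) (fun m => ∏ j, y j ^ m j) := by
  refine Eventually.of_forall fun x => ?_
  have h := hasSum_fin_prod_exp fun j => y j * x j
  rw [← Complex.exp_eq_exp_ℂ] at h
  simpa only [mul_pow, mul_div_assoc, Finset.prod_mul_distrib] using h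

/-- By the head-tail duality the exponential is `∏ (1 - w_j)^{-(n_j+1)}` with `w_j = 1 - exp
(-tailSum x j)`, and the negative binomial series expands it in powers of `w`. -/
theorem isExpCoeff_exp_sum_headSum_mul {r : ℕ} (n : Fin r → ℕ) :
    IsExpCoeff (fun x => Complex.exp (∑ j, (headSum n j : ℂ) * x j))
      (fun m => ∑ l ∈ expCoeffBox m,
        (∏ j, ((l j + n j).choose (n j) : ℂ)) * expCoeffProd m l) := by
  have hs : ∀ (j : Fin r) {w : ℂ}, ‖w‖ < 1 →
      Summable fun i : ℕ => ‖((i + n j).choose (n j) : ℂ) * w ^ i‖ := fun j w hw =>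
    (hasSum_choose_mul_geometric_of_norm_lt_one (n j) hw).summable.norm
  have h := isExpCoeff_tsum_oneSubExp
    (a := fun l : Fin r → ℕ => ∏ j, ((l j + n j).choose (n j) : ℂ))
    (ρ := 1 / 2) (by norm_num) <| by
      have hw : ‖(1 / 2 : ℂ)‖ < 1 := by norm_num
      refine (hasSum_fin_prod (f := fun j i => ((i + n j).choose (n j) : ℂ) * (1 / 2) ^ i)
        (fun j => hs j hw) fun j =>
          hasSum_choose_mul_geometric_of_norm_lt_one (n j) hw).1.congr fun l => ?_
      rw [Finset.prod_mul_distrib, norm_mul]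
      simp [norm_prod]
  filter_upwards [h, eventually_mem_bernoulliDomain r] with x hx hd
  convert hx using 1
  have h2 := (hasSum_fin_prod
    (f := fun j i => ((i + n j).choose (n j) : ℂ) * (1 - Complex.exp (-tailSum x j)) ^ i)
    (fun j => hs j (hd j)) fun j =>
      hasSum_choose_mul_geometric_of_norm_lt_one (n j) (hd j)).2.tsum_eq
  simp only [Finset.prod_mul_distrib] at h2
  rw [h2, sum_mul_headSum, Complex.exp_sum]
  refine Finset.prod_congr rfl fun j _ => ?_
  rw [sub_sub_cancel, Complex.exp_neg, inv_pow, one_div, inv_inv, ← Complex.exp_nat_mul]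

/-- The monomials in the head sums, in the basis of products of binomial coefficients. -/
theorem prod_headSum_pow_eq {r : ℕ} (k n : Fin r → ℕ) :
    ∏ j, (headSum n j : ℂ) ^ k j =
      ∑ l ∈ expCoeffBox k, (∏ j, ((n j + l j).choose (l j) : ℂ)) * expCoeffProd k l := by
  -- Two expansions of the same exponential, one direct and one through the binomial series, have
  -- equal coefficients.
  have h := congrFun ((isExpCoeff_exp_sum_mul fun j => (headSum n j : ℂ)).unique
    (isExpCoeff_exp_sum_headSum_mul n)) k
  refine h.trans (Finset.sum_congr rfl fun l _ => ?_)
  congr 1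
  refine Finset.prod_congr rfl fun j _ => ?_
  rw [add_comm, Nat.choose_symm_add]

/-! ### The polylogarithm as a rational function and its continuation -/

/-- The multiple polylogarithm of index `-k` as a rational function. -/
noncomputable def liShRational {r : ℕ} (k : Fin r → ℕ) (z : Fin r → ℂ) : ℂ :=
  ∑ l ∈ expCoeffBox k, expCoeffProd k l * ∏ j, z j / (1 - z j) ^ (l j + 1)

theorem hasSum_liShTerm_negIndex {r : ℕ} (k : Fin r → ℕ) {z : Fin r → ℂ} (hz : z ∈ polydisc r) :
    HasSum (liShTerm (negIndex k) z) (liShRational k z) := by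
  have h1 : ∀ l ∈ expCoeffBox k, HasSum (fun n : Fin r → ℕ => expCoeffProd k l *
      ∏ j, z j * (((n j + l j).choose (l j) : ℂ) * z j ^ n j))
      (expCoeffProd k l * ∏ j, z j / (1 - z j) ^ (l j + 1)) := by
    intro l _
    have h2 := fun j => (hasSum_choose_mul_geometric_of_norm_lt_one (l j) (hz j)).mul_left (z j)
    simp only [mul_one_div] at h2
    exact (hasSum_fin_prod
      (f := fun j i => z j * (((i + l j).choose (l j) : ℂ) * z j ^ i))
      (fun j => (h2 j).summable.norm) h2).2.mul_left _
  have h3 : liShTerm (negIndex k) z = fun n : Fin r → ℕ => ∑ l ∈ expCoeffBox k, expCoeffProd k l *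
      ∏ j, z j * (((n j + l j).choose (l j) : ℂ) * z j ^ n j) := by
    funext n
    rw [liShTerm, headPow_negIndex, div_inv_eq_mul, prod_headSum_pow_eq, Finset.mul_sum]
    refine Finset.sum_congr rfl fun l _ => ?_
    simp only [Finset.prod_mul_distrib, pow_succ]
    ring
  rw [h3]
  exact hasSum_sum h1

theorem analyticAt_apply_pi {r : ℕ} (j : Fin r) (z : Fin r → ℂ) :
    AnalyticAt ℂ (fun w : Fin r → ℂ => w j) z :=
  (ContinuousLinearMap.proj (R := ℂ) (φ := fun _ : Fin r => ℂ) j).analyticAt z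

theorem analyticOnNhd_liShRational {r : ℕ} (k : Fin r → ℕ) :
    AnalyticOnNhd ℂ (liShRational k) (slitDomain r) := by
  intro z hz
  refine Finset.analyticAt_fun_sum _ fun l _ => analyticAt_const.mul
    (Finset.analyticAt_fun_prod _ fun j _ => (analyticAt_apply_pi j z).div
      ((analyticAt_const.sub (analyticAt_apply_pi j z)).pow _) (pow_ne_zero _ ?_))
  exact sub_ne_zero.mpr fun h => hz j 1 le_rfl (by simpa using h.symm)

theorem isAnalyticExtension_analyticExtension {r : ℕ} {f g : (Fin r → ℂ) → ℂ}
    {U V : Set (Fin r → ℂ)} (hg : IsAnalyticExtension f U V g) :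
    IsAnalyticExtension f U V (analyticExtension f U V) := by
  have h : ∃ g, IsAnalyticExtension f U V g := ⟨g, hg⟩
  rw [analyticExtension, dif_pos h]
  exact h.choose_spec

theorem isAnalyticExtension_liShRational {r : ℕ} (k : Fin r → ℕ) :
    IsAnalyticExtension (liShSeries (negIndex k)) (polydisc r) (slitDomain r) (liShRational k) :=
  ⟨analyticOnNhd_liShRational k, fun _ hz => (hasSum_liShTerm_negIndex k hz).tsum_eq.symm⟩

theorem isOpen_polydisc (r : ℕ) : IsOpen (polydisc r) := by
  simp only [polydisc, ofPred_forall]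
  exact isOpen_iInter_of_finite fun j => isOpen_lt (by fun_prop) continuous_const

theorem zero_mem_polydisc (r : ℕ) : (0 : Fin r → ℂ) ∈ polydisc r := fun j => by simp

theorem polydisc_subset_slitDomain (r : ℕ) : polydisc r ⊆ slitDomain r := by
  intro z hz j a ha h
  have := hz j
  rw [h, Complex.norm_real, Real.norm_of_nonneg (by linarith)] at this
  linarith

/-- The domain is star-shaped about `0`: if `t * z j = a ≥ 1` with `0 < t ≤ 1`, then `z j = a / t ≥
1`. -/
theorem isPreconnected_slitDomain (r : ℕ) : IsPreconnected (slitDomain r) := by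
  refine (StarConvex.isPathConnected (a := 0) ?_
    (polydisc_subset_slitDomain r (zero_mem_polydisc r))).isConnected.isPreconnected
  rw [starConvex_zero_iff]
  intro z hz t h0 h1 j a ha h
  rw [Pi.smul_apply, Complex.real_smul] at h
  have ht : 0 < t := by
    rcases h0.eq_or_lt with rfl | h0
    · rw [Complex.ofReal_zero, zero_mul] at h
      have : a = 0 := by exact_mod_cast h.symm
      linarith
    · exact h0
  refine hz j (a / t) ((one_le_div ht).mpr (h1.trans ha)) ?_
  rw [Complex.ofReal_div, ← h, mul_div_cancel_left₀ _ (by exact_mod_cast ht.ne')]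

theorem liSh_negIndex_eqOn {r : ℕ} (k : Fin r → ℕ) :
    EqOn (liSh (negIndex k)) (liShRational k) (slitDomain r) :=
  (isAnalyticExtension_analyticExtension (isAnalyticExtension_liShRational k)).eqOn
    (isAnalyticExtension_liShRational k) (isOpen_polydisc r) ⟨0, zero_mem_polydisc r⟩
    (polydisc_subset_slitDomain r) (isPreconnected_slitDomain r)

/-! ### The integral as a sum of products of Gamma integrals -/

theorem etaIntegrand_eq {r : ℕ} (k : Fin r → ℕ) (s : Fin r → ℂ) {t : Fin r → ℝ}
    (ht : t ∈ posOrthant r) :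
    etaIntegrand k s t = ∑ l ∈ expCoeffBox k, expCoeffProd k l *
      ∏ j, ((t j : ℂ) ^ (s j - 1) * Complex.exp (-((headSum l j : ℝ) * t j))) := by
  have hT : ∀ j, 0 < tailSum t j := fun j => Finset.sum_pos (fun ν _ => ht ν) ⟨j, by simp⟩
  have hre : ∀ j, 1 - Complex.exp (tailSum t j : ℝ) = ((1 - Real.exp (tailSum t j) : ℝ) : ℂ) := by
    intro j
    push_cast
    rfl
  have hlt : ∀ j, 1 - Real.exp (tailSum t j) < 0 := fun j => by
    linarith [Real.one_lt_exp_iff.mpr (hT j)]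
  have hne : ∀ j, 1 - Complex.exp (tailSum t j : ℝ) ≠ 0 := fun j => by
    rw [hre]
    exact_mod_cast (hlt j).ne
  -- The arguments are negative reals, possibly outside the unit polydisc but never on the cut `[1,
  -- ∞)`; there the continuation is the rational function.
  have hmem : (fun j => 1 - Complex.exp (tailSum t j : ℝ)) ∈ slitDomain r := by
    intro j a ha h
    replace h := (hre j).symm.trans h
    have h' : 1 - Real.exp (tailSum t j) = a := by exact_mod_cast h
    linarith [hlt j]
  rw [etaIntegrand, liSh_negIndex_eqOn k hmem, liShRational, Finset.sum_div, Finset.mul_sum]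
  refine Finset.sum_congr rfl fun l _ => ?_
  -- Head-tail duality again, now in `t`: it separates the variables of the integral.
  have hexp : ∏ j, Complex.exp (-((headSum l j : ℝ) * t j)) =
      ∏ j, (Complex.exp (tailSum t j : ℝ) ^ (l j + 1))⁻¹ := by
    rw [← Complex.exp_sum, Finset.sum_neg_distrib, Complex.exp_neg, Finset.prod_inv_distrib]
    have h := congrArg (fun a : ℝ => (a : ℂ)) (sum_mul_headSum t l)
    push_cast at h
    push_cast
    rw [h, Complex.exp_sum]
    congr 1
    refine Finset.prod_congr rfl fun j _ => ?_
    rw [← Complex.exp_nat_mul]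
    push_cast
    rfl
  rw [Finset.prod_mul_distrib, hexp, mul_div_assoc, ← Finset.prod_div_distrib, mul_left_comm]
  congr 2
  refine Finset.prod_congr rfl fun j _ => ?_
  rw [sub_sub_cancel, div_div, mul_comm, ← div_div, div_self (hne j), one_div]

theorem measurableSet_posOrthant (r : ℕ) : MeasurableSet (posOrthant r) := by
  simp only [posOrthant, ofPred_forall]
  exact MeasurableSet.iInter fun j => measurableSet_lt measurable_const (measurable_pi_apply j)

theorem volume_restrict_posOrthant (r : ℕ) :
    (volume : Measure (Fin r → ℝ)).restrict (posOrthant r) =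
      Measure.pi fun _ => (volume : Measure ℝ).restrict (Ioi 0) := by
  rw [← Measure.restrict_pi_pi]
  congr 1
  ext t
  simp [posOrthant]

/-- The integral of a non-integrable function is `0` by convention, whereas the Gamma formula gives
a nonzero value. -/
theorem integrable_cpow_mul_exp_neg_mul {s : ℂ} (hs : 0 < s.re) {a : ℝ} (ha : 0 < a) :
    IntegrableOn (fun t : ℝ => (t : ℂ) ^ (s - 1) * Complex.exp (-(a * t))) (Ioi 0) := by
  by_contra h
  have h' := integral_undef h
  rw [Complex.integral_cpow_mul_exp_neg_mul_Ioi hs ha] at h'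
  refine mul_ne_zero ?_ (Complex.Gamma_ne_zero_of_re_pos hs) h'
  rw [Complex.cpow_ne_zero_iff]
  exact Or.inl (one_div_ne_zero (by exact_mod_cast ha.ne'))

theorem integrableOn_prod_cpow_mul_exp {r : ℕ} {s : Fin r → ℂ} (hs : s ∈ rightHalf r)
    (l : Fin r → ℕ) :
    IntegrableOn (fun t : Fin r → ℝ =>
      ∏ j, ((t j : ℂ) ^ (s j - 1) * Complex.exp (-((headSum l j : ℝ) * t j)))) (posOrthant r) := by
  rw [IntegrableOn, volume_restrict_posOrthant]
  exact Integrable.fintype_prod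
    (f := fun j (t : ℝ) => (t : ℂ) ^ (s j - 1) * Complex.exp (-((headSum l j : ℝ) * t))) fun j =>
    integrable_cpow_mul_exp_neg_mul (hs j) (by exact_mod_cast headSum_pos l j)

theorem integral_prod_cpow_mul_exp {r : ℕ} {s : Fin r → ℂ} (hs : s ∈ rightHalf r)
    (l : Fin r → ℕ) :
    ∫ t in posOrthant r,
      ∏ j, ((t j : ℂ) ^ (s j - 1) * Complex.exp (-((headSum l j : ℝ) * t j))) =
      (headPow s l)⁻¹ * ∏ j, Complex.Gamma (s j) := by
  rw [volume_restrict_posOrthant, integral_fintype_prod_eq_prod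
    (fun j (t : ℝ) => (t : ℂ) ^ (s j - 1) * Complex.exp (-((headSum l j : ℝ) * t))), headPow_eq,
    ← Finset.prod_inv_distrib, ← Finset.prod_mul_distrib]
  refine Finset.prod_congr rfl fun j _ => ?_
  have h : (0 : ℝ) < headSum l j := by exact_mod_cast headSum_pos l j
  rw [Complex.integral_cpow_mul_exp_neg_mul_Ioi (hs j) h, one_div, Complex.ofReal_natCast,
    Complex.inv_cpow _ _ (by rw [Complex.natCast_arg]; exact Real.pi_pos.ne)]

theorem integrableOn_etaIntegrand {r : ℕ} (k : Fin r → ℕ) {s : Fin r → ℂ} (hs : s ∈ rightHalf r) :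
    IntegrableOn (etaIntegrand k s) (posOrthant r) :=
  IntegrableOn.congr_fun
    (integrable_finsetSum _ fun l _ => (integrableOn_prod_cpow_mul_exp hs l).const_mul _)
    (fun _ ht => (etaIntegrand_eq k s ht).symm) (measurableSet_posOrthant r)

theorem etaIntegral_eq_sum {r : ℕ} (k : Fin r → ℕ) {s : Fin r → ℂ} (hs : s ∈ rightHalf r) :
    etaIntegral k s = ∑ l ∈ expCoeffBox k, (headPow s l)⁻¹ * expCoeffProd k l := by
  have hΓ : ∏ j, Complex.Gamma (s j) ≠ 0 :=
    Finset.prod_ne_zero_iff.mpr fun j _ => Complex.Gamma_ne_zero_of_re_pos (hs j)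
  rw [etaIntegral, setIntegral_congr_fun (measurableSet_posOrthant r)
    (fun t ht => etaIntegrand_eq k s ht), integral_finsetSum _ fun l _ =>
      (integrableOn_prod_cpow_mul_exp hs l).const_mul _, Finset.mul_sum]
  refine Finset.sum_congr rfl fun l _ => ?_
  rw [integral_const_mul, integral_prod_cpow_mul_exp hs]
  field_simp

/-! ### Entire continuation in `s` and the equality -/

/-- The bases are positive integers independent of `s`, so each power is entire in its exponent and
never zero. -/
theorem isAnalyticExtension_sum_headPow_inv {r : ℕ} (k : Fin r → ℕ) :
    IsAnalyticExtension (etaIntegral k) (rightHalf r) univ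
      (fun s => ∑ l ∈ expCoeffBox k, (headPow s l)⁻¹ * expCoeffProd k l) := by
  refine ⟨fun s _ => ?_, fun s hs => (etaIntegral_eq_sum k hs).symm⟩
  refine Finset.analyticAt_fun_sum _ fun l _ => AnalyticAt.mul (AnalyticAt.inv ?_ ?_)
    analyticAt_const
  · refine Finset.analyticAt_fun_prod _ fun j _ =>
      analyticAt_const.cpow (analyticAt_apply_pi j s) ?_
    exact Complex.natCast_mem_slitPlane.mpr (headSum_pos l j).ne'
  · rw [headPow_eq, Finset.prod_ne_zero_iff]
    intro j _
    rw [Complex.cpow_ne_zero_iff]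
    exact Or.inl (by exact_mod_cast (headSum_pos l j).ne')

theorem isOpen_rightHalf (r : ℕ) : IsOpen (rightHalf r) := by
  simp only [rightHalf, ofPred_forall]
  exact isOpen_iInter_of_finite fun j => isOpen_lt continuous_const (by fun_prop)

theorem isAnalyticExtension_multiEta {r : ℕ} (k : Fin r → ℕ) :
    IsAnalyticExtension (etaIntegral k) (rightHalf r) univ (multiEta k) :=
  isAnalyticExtension_analyticExtension (isAnalyticExtension_sum_headPow_inv k)

theorem multiEta_eq_sum {r : ℕ} (k : Fin r → ℕ) (s : Fin r → ℂ) :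
    multiEta k s = ∑ l ∈ expCoeffBox k, (headPow s l)⁻¹ * expCoeffProd k l :=
  (isAnalyticExtension_multiEta k).eqOn (isAnalyticExtension_sum_headPow_inv k)
    (isOpen_rightHalf r) ⟨fun _ => 1, fun _ => by simp⟩ (subset_univ _) isPreconnected_univ
    (mem_univ s)

theorem theorem5p7 {r : ℕ} (k : Fin r → ℕ) :
    -- the multiple polylogarithm of index `-k` is well defined
    (∀ z ∈ polydisc r, Summable (liShTerm (negIndex k) z)) ∧
    IsAnalyticExtension (liShSeries (negIndex k)) (polydisc r) (slitDomain r)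
      (liSh (negIndex k)) ∧
    -- the integral converges absolutely, and `multiEta k` is its entire continuation
    (∀ s ∈ rightHalf r, IntegrableOn (etaIntegrand k s) (posOrthant r)) ∧
    IsAnalyticExtension (etaIntegral k) (rightHalf r) univ (multiEta k) ∧
    -- the poly-Bernoulli numbers are the coefficients of their generating function
    (∀ s : Fin r → ℂ, (∀ x ∈ bernoulliDomain r, Summable (bernoulliGenTerm s x)) ∧
      IsExpCoeff (bernoulliGen s) (multiPolyBernoulli s)) ∧
    -- the equality
    ∀ s : Fin r → ℂ, multiEta k s = multiPolyBernoulli s k := by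
  exact ⟨fun z hz => (hasSum_liShTerm_negIndex k hz).summable,
    isAnalyticExtension_analyticExtension (isAnalyticExtension_liShRational k),
    fun s hs => integrableOn_etaIntegrand k hs, isAnalyticExtension_multiEta k,
    fun s => ⟨fun x hx => summable_bernoulliGenTerm s hx, multiPolyBernoulli_spec s⟩,
    fun s => (multiEta_eq_sum k s).trans (multiPolyBernoulli_eq_sum s k).symm⟩
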